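/- **Model.** Let $B_n=\{0,1\}^n$ and, for $X=(x_1,\dots,x_n)\in B_n$, let $a_X=\frac1n\sum_{i=1}^n x_i$. A quantum algorithm with $T$ queries on $B_n$ works on finitely many qubits, divided into an index register, one target qubit and a workspace. It starts in a unit vector $|\psi_0\rangle$ and produces the state $|\psi_X\rangle=U_TQ_XU_{T-1}Q_X\cdots U_1Q_XU_0|\psi_0\rangle$, where $Q_X|i,b,z\rangle=|i,b\oplus x_i,z\rangle$ ($Q_X$ fixes the basis states whose index addresses no variable). Then $|\psi_X\rangle$ is measured by a quantum measurement with finitely many outcomes; outcome $j$ occurs with probability $p_X(j)$, and the algorithm then returns a real number $\hat a(j)$. The vector $|\psi_0\rangle$, the unitary operators $U_0,\dots,U_T$, the measurement and the map $\hat a$ may be arbitrary but do not depend on $X$. For $p\in(\frac12,1]$ the error of the algorithm on input $X$ is $$e(X,T,p)=\inf\Big\{\gamma:\ \sum_{j:\,|a_X-\hat a(j)|\le\gamma}p_X(j)\ge p\Big\},$$ and its average probabilistic error with respect to the uniform measure $\mu_1$ on $B_n$ is $$e^{\mathrm{avp}}(B_n,T,p)=\sum_{X\in B_n}2^{-n}\,e(X,T,p).$$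 **Theorem 3.2.** There are absolute constants $c_1,c_2>0$ such that the following two statements hold for every $p\in(\frac12,1]$. (1) Let $T=T(n)\ge 0$ be integers with $T(n)=o(n)$. Then, for all sufficiently large $n$, every quantum algorithm with $T(n)$ queries on $B_n$ satisfies $$e^{\mathrm{avp}}(B_n,T,p)\ \ge\ c_1\min\{n^{-1/2},\,T^{-1}\},$$ where the minimum is $n^{-1/2}$ if $T=0$. (2) Let $\varepsilon=\varepsilon(n)>0$ with $\varepsilon(n)=o(n^{-1/2})$. Then, for all sufficiently large $n$, every quantum algorithm on $B_n$, with any number $T$ of queries, for which $e^{\mathrm{avp}}(B_n,T,p)\le\varepsilon$ satisfies $$T\ \ge\ c_2\min\{\varepsilon^{-1},\,n\}.$$ -/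

import Mathlib

open Filter Asymptotics

noncomputable section

namespace BoolMean

/-- The class `B_n = {0,1}^n` of inputs. -/
abbrev Input (n : ℕ) : Type := Fin n → Bool

/-- The mean `a_X = |X| / n`, where `|X|` is the number of ones of `X`. -/
def mean {n : ℕ} (X : Input n) : ℝ :=
  (∑ i, if X i then (1 : ℝ) else 0) / n

/-- Labels `(i, b, z)` of the computational basis of `ℓ + 1 + w` qubits: an index register `i` of
`ℓ` qubits, a target qubit `b`, and a workspace `z` of `w` qubits. -/
abbrev BasisLabel (ℓ w : ℕ) : Type := Fin (2 ^ ℓ) × Bool × Fin (2 ^ w)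

/-- The state space of `ℓ + 1 + w` qubits, in coordinates for the computational basis. -/
abbrev StateSpace (ℓ w : ℕ) : Type := EuclideanSpace ℂ (BasisLabel ℓ w)

/-- The oracle's answer `x_i` (indices start at `0`); an index `i ≥ n` addresses no variable and is
answered by `0`, so that a query leaves the corresponding basis states fixed. -/
def oracleBit {n : ℕ} (X : Input n) (i : ℕ) : Bool :=
  if h : i < n then X ⟨i, h⟩ else false

/-- The permutation `(i, b, z) ↦ (i, b ⊕ x_i, z)` of the basis labels. -/
def queryPerm {n : ℕ} (ℓ w : ℕ) (X : Input n) : Equiv.Perm (BasisLabel ℓ w) where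
  toFun s := (s.1, xor s.2.1 (oracleBit X s.1), s.2.2)
  invFun s := (s.1, xor s.2.1 (oracleBit X s.1), s.2.2)
  left_inv s := by simp
  right_inv s := by simp

/-- The query `Q_X`, the unitary operator `|i, b, z⟩ ↦ |i, b ⊕ x_i, z⟩`. -/
def queryOp {n : ℕ} (ℓ w : ℕ) (X : Input n) : StateSpace ℓ w ≃ₗᵢ[ℂ] StateSpace ℓ w :=
  LinearIsometryEquiv.piLpCongrLeft 2 ℂ ℂ (queryPerm ℓ w X)

/-- A quantum algorithm with `T` queries for the approximation of the mean on `B_n`: everything in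
it is independent of the input `X`, which enters only through the queries. -/
structure QuantumAlgorithm (n T : ℕ) where
  /-- number of qubits of the index register -/
  indexQubits : ℕ
  /-- number of qubits of the workspace -/
  workQubits : ℕ
  /-- every variable can be addressed -/
  le_two_pow : n ≤ 2 ^ indexQubits
  /-- the initial state `ψ₀` -/
  init : StateSpace indexQubits workQubits
  norm_init : ‖init‖ = 1
  /-- the unitary transformations `U_t`, of which only `U_0, …, U_T` are applied -/
  gate : ℕ → (StateSpace indexQubits workQubits ≃ₗᵢ[ℂ] StateSpace indexQubits workQubits)
  /-- the number `M` of outcomes of the final measurement -/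
  numOutcomes : ℕ
  /-- the measurement operators, one for each outcome -/
  measOp : Fin numOutcomes →
    (StateSpace indexQubits workQubits →L[ℂ] StateSpace indexQubits workQubits)
  /-- completeness relation of the measurement -/
  measOp_complete :
    ∑ j, (ContinuousLinearMap.adjoint (measOp j)).comp (measOp j) = ContinuousLinearMap.id ℂ _
  /-- the approximation of the mean that is returned on outcome `j` -/
  estimate : Fin numOutcomes → ℝ

namespace QuantumAlgorithm

variable {n T : ℕ}

/-- The state `U_t Q_X U_{t-1} Q_X ⋯ U_1 Q_X U_0 ψ₀` after `t` queries. -/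
def stateAfter (A : QuantumAlgorithm n T) (X : Input n) :
    ℕ → StateSpace A.indexQubits A.workQubits
  | 0 => A.gate 0 A.init
  | t + 1 => A.gate (t + 1) (queryOp A.indexQubits A.workQubits X (A.stateAfter X t))

/-- The probability `p_X(j)` of outcome `j` when the final state, after `T` queries, is measured. -/
def outcomeProb (A : QuantumAlgorithm n T) (X : Input n) (j : Fin A.numOutcomes) : ℝ :=
  ‖A.measOp j (A.stateAfter X T)‖ ^ 2

/-- The error `e(X, T, p)`: the infimum of all `γ` for which the estimate is within `γ` of the mean
with probability at least `p`. -/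
def error (A : QuantumAlgorithm n T) (p : ℝ) (X : Input n) : ℝ :=
  sInf {γ : ℝ | p ≤ ∑ j with |mean X - A.estimate j| ≤ γ, A.outcomeProb X j}

/-- The average probabilistic error `e^avp(B_n, T, p) = ∑_X e(X, T, p) μ(X)` for a probability on
`B_n` with point masses `μ(X)`. -/
def avgError (A : QuantumAlgorithm n T) (p : ℝ) (μ : Input n → ℝ) : ℝ :=
  ∑ X, A.error p X * μ X

end QuantumAlgorithm

/-- The uniform probability `μ₁` on `B_n`. -/
def mu1 (n : ℕ) : Input n → ℝ := fun _ => ((2 : ℝ) ^ n)⁻¹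

end BoolMean

end

namespace BoolMean

/-! ### Product weights and their push-forwards. -/

section ProductWeights

variable {ι α β : Type*} [Fintype ι] [DecidableEq ι] [Fintype α] [Fintype β] [DecidableEq β]

/-! Couple three inputs `Z ≤ X ≤ Y`: `X` is uniform, and independent marks of probability `q` select
sites where `Y` is forced to one and `Z` to zero. The mean gaps are typically about `q / 2`, and an
exponential moment bounds their lower tails. Since `n * q ^ 2 ≤ 1`, the laws of `Y` and `Z` have
bounded second moment relative to the uniform law, so small average error makes all three errors
small with good probability.

Yet the algorithm hardly separates the inputs. A query raises the squared distance of two states by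
at most twice the masses, in each state, of the sites where the inputs differ. Each state depends on
its own input only, given which every site differs with probability at most `q`. Hence the expected
squared distance after `T` queries is at most `4 * q * T`: linear, not quadratic, in `T`.

Three inputs are used because `p` may be close to `1 / 2`: two disjoint accepting sets contradict
total probability only by a margin vanishing with `2 * p - 1`, three by an absolute one. Taking `q`
of order `1 / max (√n) T` gives both bounds. -/

theorem sum_pi_prod (g : ι → α → ℝ) : ∑ ω : ι → α, ∏ i, g i (ω i) = ∏ i, ∑ a, g i a := by
  rw [Finset.prod_univ_sum, Fintype.piFinset_univ]

/-- Push-forward of a product weight along a coordinatewise map. -/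
theorem sum_pi_prod_mul_comp (g : ι → α → ℝ) (u : α → β) (F : (ι → β) → ℝ) :
    ∑ ω : ι → α, (∏ i, g i (ω i)) * F (fun i => u (ω i)) =
      ∑ X : ι → β, (∏ i, ∑ a, if u a = X i then g i a else 0) * F X := by
  have key : ∀ X : ι → β, (∏ i, ∑ a, if u a = X i then g i a else 0) =
      ∑ ω : ι → α, if (fun i => u (ω i)) = X then ∏ i, g i (ω i) else 0 := by
    intro X
    rw [← sum_pi_prod (fun i a => if u a = X i then g i a else 0)]
    refine Finset.sum_congr rfl fun ω _ => ?_
    rw [Finset.prod_ite_zero]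
    simp [funext_iff]
  simp_rw [key, Finset.sum_mul]
  rw [Finset.sum_comm]
  refine Finset.sum_congr rfl fun ω _ => ?_
  simp

/-- If, given the value of `u` at a site, the conditional weight of `u ≠ v` is at most `q`, then
the same holds at every site given the whole configuration of `u`-values. -/
theorem sum_pi_ne_le (w : α → ℝ) (hw : ∀ a, 0 ≤ w a) (u v : α → β) (q : ℝ)
    (hq : ∀ b, ∑ a, (if u a = b then (if u a ≠ v a then w a else 0) else 0) ≤
      q * ∑ a, if u a = b then w a else 0)
    (F : (ι → β) → ℝ) (hF : ∀ X, 0 ≤ F X) (i : ι) :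
    ∑ ω : ι → α, (∏ j, w (ω j)) * (if u (ω i) ≠ v (ω i) then F (fun j => u (ω j)) else 0) ≤
      q * ∑ ω : ι → α, (∏ j, w (ω j)) * F (fun j => u (ω j)) := by
  -- The event concerns site `i` alone, so it is absorbed into the `i`-th factor; after push-forward
  -- along `u` only that factor differs.
  have h1 : ∀ ω : ι → α,
      (∏ j, w (ω j)) * (if u (ω i) ≠ v (ω i) then F (fun j => u (ω j)) else 0) =
      (∏ j, (fun j a => if j = i then (if u a ≠ v a then w a else 0) else w a) j (ω j)) *
        F (fun j => u (ω j)) := by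
    intro ω
    rw [← Finset.mul_prod_erase _ _ (Finset.mem_univ i),
      ← Finset.mul_prod_erase _ (fun j => (fun j a => if j = i then
        (if u a ≠ v a then w a else 0) else w a) j (ω j)) (Finset.mem_univ i)]
    have : ∏ j ∈ Finset.univ.erase i,
        (if j = i then (if u (ω j) ≠ v (ω j) then w (ω j) else 0) else w (ω j)) =
        ∏ j ∈ Finset.univ.erase i, w (ω j) :=
      Finset.prod_congr rfl fun j hj => by rw [if_neg (Finset.ne_of_mem_erase hj)]
    simp only [this, if_true]
    split_ifs <;> simp
  simp_rw [h1]
  rw [sum_pi_prod_mul_comp (fun j a => if j = i then (if u a ≠ v a then w a else 0) else w a),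
    sum_pi_prod_mul_comp (fun _ => w), Finset.mul_sum]
  refine Finset.sum_le_sum fun X _ => ?_
  rw [← mul_assoc]
  refine mul_le_mul_of_nonneg_right ?_ (hF X)
  rw [← Finset.mul_prod_erase _ _ (Finset.mem_univ i),
      ← Finset.mul_prod_erase _ (fun j => ∑ a, if u a = X j then w a else 0)
        (Finset.mem_univ i), ← mul_assoc]
  have : ∏ j ∈ Finset.univ.erase i, (∑ a, if u a = X j then
        (if j = i then (if u a ≠ v a then w a else 0) else w a) else 0) =
        ∏ j ∈ Finset.univ.erase i, ∑ a, (if u a = X j then w a else 0) :=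
      Finset.prod_congr rfl fun j hj => by simp [Finset.ne_of_mem_erase hj]
  rw [this]
  refine mul_le_mul_of_nonneg_right ?_ ?_
  · simpa using hq (X i)
  · exact Finset.prod_nonneg fun j _ => Finset.sum_nonneg fun a _ => by
      split_ifs <;> simp [hw]

end ProductWeights

/-! ### Effect of one query on the distance of two states. -/

/-- The sum of the squared moduli of the amplitudes on which `Q_X` and `Q_Y` act differently. -/
noncomputable def disagreeMass {n ℓ w : ℕ} (X Y : Input n) (ψ : StateSpace ℓ w) : ℝ :=
  ∑ s : BasisLabel ℓ w, if oracleBit X s.1 ≠ oracleBit Y s.1 then ‖ψ s‖ ^ 2 else 0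

theorem disagreeMass_comm {n ℓ w : ℕ} (X Y : Input n) (ψ : StateSpace ℓ w) :
    disagreeMass X Y ψ = disagreeMass Y X ψ := by
  simp only [disagreeMass, ne_comm]

theorem queryOp_apply {n ℓ w : ℕ} (X : Input n) (ψ : StateSpace ℓ w) (s : BasisLabel ℓ w) :
    queryOp ℓ w X ψ s = ψ (queryPerm ℓ w X s) := by
  simp [queryOp, LinearIsometryEquiv.piLpCongrLeft_apply, Equiv.piCongrLeft'_apply, queryPerm]

theorem disagreeMass_queryOp {n ℓ w : ℕ} (X Y Z : Input n) (ψ : StateSpace ℓ w) :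
    disagreeMass X Y (queryOp ℓ w Z ψ) = disagreeMass X Y ψ := by
  unfold disagreeMass
  simp_rw [queryOp_apply]
  exact Equiv.sum_comp (queryPerm ℓ w Z)
    (fun s => if oracleBit X s.1 ≠ oracleBit Y s.1 then ‖ψ s‖ ^ 2 else 0)

/-- Where the oracles agree, both queries permute coordinates alike, so nothing changes; elsewhere
`‖a - b‖² ≤ 2‖a‖² + 2‖b‖²`. No cross term appears, so the bounds add up over the queries. -/
theorem norm_sq_queryOp_sub_le {n ℓ w : ℕ} (X Y : Input n) (ψ φ : StateSpace ℓ w) :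
    ‖queryOp ℓ w X ψ - queryOp ℓ w Y φ‖ ^ 2 ≤
      ‖ψ - φ‖ ^ 2 + 2 * (disagreeMass X Y ψ + disagreeMass X Y φ) := by
  rw [← disagreeMass_queryOp X Y X ψ, ← disagreeMass_queryOp X Y Y φ,
    ← (queryOp ℓ w X).norm_map (ψ - φ), map_sub, EuclideanSpace.norm_sq_eq,
    EuclideanSpace.norm_sq_eq]
  unfold disagreeMass
  rw [← Finset.sum_add_distrib, Finset.mul_sum, ← Finset.sum_add_distrib]
  refine Finset.sum_le_sum fun s _ => ?_
  simp only [PiLp.sub_apply]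
  split_ifs with h
  · have h1 := norm_sub_le (queryOp ℓ w X ψ s) (queryOp ℓ w Y φ s)
    nlinarith [sq_nonneg (‖queryOp ℓ w X ψ s‖ - ‖queryOp ℓ w Y φ s‖),
      sq_nonneg ‖queryOp ℓ w X ψ s - queryOp ℓ w X φ s‖,
      norm_nonneg (queryOp ℓ w X ψ s - queryOp ℓ w Y φ s)]
  · have h2 : queryPerm ℓ w X s = queryPerm ℓ w Y s := by
      simp only [queryPerm, Equiv.coe_fn_mk, not_not.mp h]
    simp [queryOp_apply, h2]

/-! ### States, measurement statistics and the error. -/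

namespace QuantumAlgorithm

variable {n T : ℕ} (A : QuantumAlgorithm n T)

theorem norm_stateAfter (X : Input n) (t : ℕ) : ‖A.stateAfter X t‖ = 1 := by
  induction t with
  | zero => simp [stateAfter, A.norm_init]
  | succ t ih => simp [stateAfter, ih]

theorem norm_sq_stateAfter_succ_sub_le (X Y : Input n) (t : ℕ) :
    ‖A.stateAfter X (t + 1) - A.stateAfter Y (t + 1)‖ ^ 2 ≤
      ‖A.stateAfter X t - A.stateAfter Y t‖ ^ 2 +
        2 * (disagreeMass X Y (A.stateAfter X t) + disagreeMass X Y (A.stateAfter Y t)) := by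
  simp only [stateAfter, ← map_sub, LinearIsometryEquiv.norm_map]
  exact norm_sq_queryOp_sub_le X Y _ _

theorem sum_norm_sq_measOp (ψ : StateSpace A.indexQubits A.workQubits) :
    ∑ j, ‖A.measOp j ψ‖ ^ 2 = ‖ψ‖ ^ 2 := by
  have h := congrArg (fun L => RCLike.re (inner ℂ ψ (L ψ))) A.measOp_complete
  simp only [sum_apply, ContinuousLinearMap.comp_apply, inner_sum,
    ContinuousLinearMap.adjoint_inner_right, map_sum, ContinuousLinearMap.id_apply,
    inner_self_eq_norm_sq] at h
  exact h

theorem outcomeProb_nonneg (X : Input n) (j : Fin A.numOutcomes) : 0 ≤ A.outcomeProb X j :=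
  sq_nonneg _

theorem sum_outcomeProb (X : Input n) : ∑ j, A.outcomeProb X j = 1 := by
  simp only [outcomeProb, sum_norm_sq_measOp, norm_stateAfter, one_pow]

/-- Close final states have similar outcome distributions. -/
theorem sum_outcomeProb_le (X Y : Input n) (S : Finset (Fin A.numOutcomes)) :
    ∑ j ∈ S, A.outcomeProb Y j ≤ 5 / 4 * ∑ j ∈ S, A.outcomeProb X j +
      5 * ‖A.stateAfter X T - A.stateAfter Y T‖ ^ 2 := by
  have h1 : ∑ j ∈ S, ‖A.measOp j (A.stateAfter X T - A.stateAfter Y T)‖ ^ 2 ≤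
      ‖A.stateAfter X T - A.stateAfter Y T‖ ^ 2 := by
    rw [← A.sum_norm_sq_measOp]
    exact Finset.sum_le_sum_of_subset_of_nonneg (Finset.subset_univ S) fun _ _ _ => sq_nonneg _
  have h2 : ∑ j ∈ S, A.outcomeProb Y j ≤ ∑ j ∈ S, (5 / 4 * A.outcomeProb X j +
      5 * ‖A.measOp j (A.stateAfter X T - A.stateAfter Y T)‖ ^ 2) := by
    refine Finset.sum_le_sum fun j _ => ?_
    have h3 := norm_sub_norm_le (A.measOp j (A.stateAfter Y T)) (A.measOp j (A.stateAfter X T))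
    rw [norm_sub_rev, ← map_sub] at h3
    unfold outcomeProb
    set x := ‖A.measOp j (A.stateAfter X T)‖ with hx
    set d := ‖A.measOp j (A.stateAfter X T - A.stateAfter Y T)‖ with hd
    have h4 : ‖A.measOp j (A.stateAfter Y T)‖ ^ 2 ≤ (x + d) ^ 2 :=
      pow_le_pow_left₀ (norm_nonneg _) (by linarith) 2
    -- Young's inequality `2xd ≤ x² / 4 + 4d²`.
    nlinarith [sq_nonneg (x - 4 * d)]
  rw [Finset.sum_add_distrib, ← Finset.mul_sum, ← Finset.mul_sum] at h2
  linarith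

variable {p : ℝ}

theorem error_nonneg (hp : 0 < p) (X : Input n) : 0 ≤ A.error p X := by
  refine Real.sInf_nonneg fun γ hγ => ?_
  by_contra! hneg
  have : (Finset.univ.filter fun j => |mean X - A.estimate j| ≤ γ) = ∅ :=
    Finset.filter_eq_empty_iff.mpr fun j _ => by linarith [abs_nonneg (mean X - A.estimate j)]
  simp only [Set.mem_ofPred_eq, this, Finset.sum_empty] at hγ
  linarith

/-- Success probability grows with `γ`. The hypothesis `p ≤ 1` makes the set of admissible `γ`
nonempty, excluding the default value `sInf ∅ = 0`. -/
theorem le_sum_outcomeProb_of_error_lt (hp1 : p ≤ 1) {X : Input n} {γ : ℝ}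
    (h : A.error p X < γ) : p ≤ ∑ j with |mean X - A.estimate j| ≤ γ, A.outcomeProb X j := by
  have hne : {γ : ℝ | p ≤ ∑ j with |mean X - A.estimate j| ≤ γ, A.outcomeProb X j}.Nonempty := by
    refine ⟨∑ j, |mean X - A.estimate j|, ?_⟩
    have : (Finset.univ.filter fun j => |mean X - A.estimate j| ≤
        ∑ j, |mean X - A.estimate j|) = Finset.univ :=
      Finset.filter_true_of_mem fun j hj =>
        Finset.single_le_sum (f := fun j => |mean X - A.estimate j|)
          (fun _ _ => abs_nonneg _) hj
    simp only [Set.mem_ofPred_eq, this, sum_outcomeProb, hp1]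
  obtain ⟨γ', hγ', hlt⟩ := exists_lt_of_csInf_lt hne h
  refine le_trans hγ' (Finset.sum_le_sum_of_subset_of_nonneg ?_ fun j _ _ =>
    A.outcomeProb_nonneg X j)
  intro j
  simp only [Finset.mem_filter, Finset.mem_univ, true_and]
  intro hj
  linarith

/-- Three inputs with well separated means and close final states cannot all have small error. -/
theorem not_three_errors_lt (hp : 1 / 2 < p) (hp1 : p ≤ 1) {X Y Z : Input n} {γ : ℝ}
    (hX : A.error p X < γ) (hY : A.error p Y < γ) (hZ : A.error p Z < γ)
    (hXY : 2 * γ < mean Y - mean X) (hZX : 2 * γ < mean X - mean Z)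
    (hdY : ‖A.stateAfter X T - A.stateAfter Y T‖ ^ 2 ≤ 1 / 30)
    (hdZ : ‖A.stateAfter X T - A.stateAfter Z T‖ ^ 2 ≤ 1 / 30) : False := by
  have hX' := A.le_sum_outcomeProb_of_error_lt hp1 hX
  have hY' := A.le_sum_outcomeProb_of_error_lt hp1 hY
  have hZ' := A.le_sum_outcomeProb_of_error_lt hp1 hZ
  have hγ : 0 ≤ γ := (A.error_nonneg (by linarith) X).trans hX.le
  set S : Input n → Finset (Fin A.numOutcomes) := fun X =>
    Finset.univ.filter fun j => |mean X - A.estimate j| ≤ γ with hS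
  have disj : ∀ U V : Input n, 2 * γ < mean V - mean U → Disjoint (S U) (S V) := by
    intro U V hUV
    rw [Finset.disjoint_left]
    intro j hj hj'
    simp only [hS, Finset.mem_filter, Finset.mem_univ, true_and, abs_le] at hj hj'
    linarith [hj.1, hj.2, hj'.1, hj'.2]
  have e1 := A.sum_outcomeProb_le X Y (S Y)
  have e2 := A.sum_outcomeProb_le X Z (S Z)
  have e3 : ∑ j ∈ S X, A.outcomeProb X j + ∑ j ∈ S Y, A.outcomeProb X j +
      ∑ j ∈ S Z, A.outcomeProb X j ≤ 1 := by
    rw [← Finset.sum_union (disj X Y hXY), ← Finset.sum_union, ← A.sum_outcomeProb X]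
    · exact Finset.sum_le_sum_of_subset_of_nonneg (Finset.subset_univ _) fun j _ _ =>
        A.outcomeProb_nonneg X j
    · exact Finset.disjoint_union_left.mpr
        ⟨(disj Z X hZX).symm, (disj Z Y (by linarith)).symm⟩
  change p ≤ ∑ j ∈ S X, _ at hX'
  change p ≤ ∑ j ∈ S Y, _ at hY'
  change p ≤ ∑ j ∈ S Z, _ at hZ'
  -- On input `X` the other two sets have probability at least `4/5 * (p - 1/6) > 4/15` each, and
  -- `1/2 + 8/15 > 1`.
  linarith

end QuantumAlgorithm

/-! ### The coupling: distances, change of measure, tail bound. -/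

section Coupling

/-- The weight of one site `(x, d)` of the coupling: `x` is a fair bit and `d` an independent bit
that is `1` with probability `q`. -/
noncomputable def siteWeight (q : ℝ) (a : Bool × Bool) : ℝ := if a.2 then q / 2 else (1 - q) / 2

/-- The product weight on `n` independent sites. -/
noncomputable def weight {n : ℕ} (q : ℝ) (ω : Fin n → Bool × Bool) : ℝ :=
  ∏ i, siteWeight q (ω i)

variable {n : ℕ} {q : ℝ}

theorem siteWeight_nonneg (h0 : 0 ≤ q) (h1 : q ≤ 1) (a : Bool × Bool) : 0 ≤ siteWeight q a := by
  unfold siteWeight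
  split_ifs <;> linarith

theorem weight_nonneg (h0 : 0 ≤ q) (h1 : q ≤ 1) (ω : Fin n → Bool × Bool) : 0 ≤ weight q ω :=
  Finset.prod_nonneg fun _ _ => siteWeight_nonneg h0 h1 _

theorem sum_weight : ∑ ω : Fin n → Bool × Bool, weight q ω = 1 := by
  unfold weight
  rw [sum_pi_prod fun _ => siteWeight q]
  have : ∑ a, siteWeight q a = 1 := by
    simp [Fintype.sum_prod_type, siteWeight]; ring
  simp [this]

theorem sum_weight_mul_fst (F : Input n → ℝ) :
    ∑ ω : Fin n → Bool × Bool, weight q ω * F (fun i => (ω i).1) = ∑ X, F X * mu1 n X := by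
  unfold weight
  rw [sum_pi_prod_mul_comp (fun _ => siteWeight q) Prod.fst]
  refine Finset.sum_congr rfl fun X _ => ?_
  have : ∀ b : Bool, (∑ a, if a.1 = b then siteWeight q a else 0) = 2⁻¹ := by
    intro b
    cases b <;> simp [Fintype.sum_prod_type, siteWeight] <;> ring
  simp only [this, mu1]
  simp [mul_comm]

/-- If the conditional probabilities of a disagreement of the `u`- and the `v`-configuration are at
most `q`, in both directions, then the expected squared distance of the final states is at most
`4qT`. -/
theorem sum_weight_mul_norm_sq_le {T : ℕ} (A : QuantumAlgorithm n T) (h0 : 0 ≤ q) (h1 : q ≤ 1)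
    (u v : Bool × Bool → Bool)
    (hu : ∀ b, ∑ a, (if u a = b then (if u a ≠ v a then siteWeight q a else 0) else 0) ≤
      q * ∑ a, if u a = b then siteWeight q a else 0)
    (hv : ∀ b, ∑ a, (if v a = b then (if v a ≠ u a then siteWeight q a else 0) else 0) ≤
      q * ∑ a, if v a = b then siteWeight q a else 0) (t : ℕ) :
    ∑ ω : Fin n → Bool × Bool, weight q ω * ‖A.stateAfter (fun i => u (ω i)) t -
      A.stateAfter (fun i => v (ω i)) t‖ ^ 2 ≤ 4 * q * t := by
  have mass : ∀ (u v : Bool × Bool → Bool) (t : ℕ)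
      (hu : ∀ b, ∑ a, (if u a = b then (if u a ≠ v a then siteWeight q a else 0) else 0) ≤
        q * ∑ a, if u a = b then siteWeight q a else 0),
      ∑ ω : Fin n → Bool × Bool, weight q ω * disagreeMass (fun i => u (ω i)) (fun i => v (ω i))
        (A.stateAfter (fun i => u (ω i)) t) ≤ q := by
    intro u v t hu
    have hsum : ∑ s, ∑ ω : Fin n → Bool × Bool,
        weight q ω * ‖A.stateAfter (fun i => u (ω i)) t s‖ ^ 2 = 1 := by
      rw [Finset.sum_comm]
      simp_rw [← Finset.mul_sum, ← EuclideanSpace.norm_sq_eq, A.norm_stateAfter]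
      simp [sum_weight]
    unfold disagreeMass
    simp_rw [Finset.mul_sum]
    rw [Finset.sum_comm]
    refine le_of_le_of_eq ?_ ((congrArg (q * ·) hsum).trans (mul_one q))
    refine le_of_le_of_eq ?_ (Finset.mul_sum _ _ _).symm
    refine Finset.sum_le_sum fun s _ => ?_
    by_cases hs : (s.1 : ℕ) < n
    · simp only [oracleBit, hs, dif_pos]
      exact sum_pi_ne_le (siteWeight q) (siteWeight_nonneg h0 h1) u v q hu
        (fun X => ‖A.stateAfter X t s‖ ^ 2) (fun X => sq_nonneg _) ⟨s.1, hs⟩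
    -- Such an index addresses no variable, so the oracles agree there.
    · simp only [oracleBit, hs, dif_neg, not_false_eq_true, ne_eq, not_true_eq_false, if_false,
        mul_zero, Finset.sum_const_zero]
      exact mul_nonneg h0 (Finset.sum_nonneg fun ω _ =>
        mul_nonneg (weight_nonneg h0 h1 ω) (sq_nonneg _))
  induction t with
  | zero => simp [QuantumAlgorithm.stateAfter]
  | succ t ih =>
    have e1 := mass u v t hu
    have e2 := mass v u t hv
    simp_rw [disagreeMass_comm (fun i => v _)] at e2
    have e3 : ∑ ω : Fin n → Bool × Bool, weight q ω * ‖A.stateAfter (fun i => u (ω i)) (t + 1) -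
        A.stateAfter (fun i => v (ω i)) (t + 1)‖ ^ 2 ≤
        ∑ ω : Fin n → Bool × Bool, (weight q ω * ‖A.stateAfter (fun i => u (ω i)) t -
          A.stateAfter (fun i => v (ω i)) t‖ ^ 2 +
        2 * (weight q ω * disagreeMass (fun i => u (ω i)) (fun i => v (ω i))
            (A.stateAfter (fun i => u (ω i)) t) +
          weight q ω * disagreeMass (fun i => u (ω i)) (fun i => v (ω i))
            (A.stateAfter (fun i => v (ω i)) t))) := by
      refine Finset.sum_le_sum fun ω _ => ?_
      have := mul_le_mul_of_nonneg_left (A.norm_sq_stateAfter_succ_sub_le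
        (fun i => u (ω i)) (fun i => v (ω i)) t) (weight_nonneg h0 h1 ω)
      linarith
    rw [Finset.sum_add_distrib, ← Finset.mul_sum, Finset.sum_add_distrib] at e3
    push_cast
    linarith

/-- A bad event of small uniform probability is also unlikely under a slightly biased product
distribution; the bad event is `f ≥ 1`. -/
theorem sum_weight_indicator_le (hnq : n * q ^ 2 ≤ 1)
    (v : Bool × Bool → Bool) (hv : ∑ b, (∑ a, if v a = b then siteWeight q a else 0) ^ 2 =
      (1 + q ^ 2) / 2) (f : Input n → ℝ) (hf : ∀ X, 0 ≤ f X) :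
    ∑ ω : Fin n → Bool × Bool, weight q ω * (if 1 ≤ f (fun i => v (ω i)) then 1 else 0) ≤
      3 / 100 + 25 * ∑ X, f X * mu1 n X := by
  unfold weight
  rw [sum_pi_prod_mul_comp (fun _ => siteWeight q) v (fun X => if 1 ≤ f X then (1 : ℝ) else 0)]
  set ν : Bool → ℝ := fun b => ∑ a, if v a = b then siteWeight q a else 0 with hν
  -- Second moment of the density of `ν^n` relative to the uniform law; it equals `(1 + q ^ 2) ^ n ≤
  -- e`.
  have h2 : ∑ X : Input n, (2 : ℝ) ^ n * (∏ i, ν (X i)) ^ 2 ≤ 3 := by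
    have e1 : ∀ X : Input n, (2 : ℝ) ^ n * (∏ i, ν (X i)) ^ 2 = ∏ i, 2 * ν (X i) ^ 2 := by
      intro X
      rw [Finset.prod_mul_distrib, Finset.prod_pow]
      simp
    simp_rw [e1]
    rw [sum_pi_prod (fun (_ : Fin n) b => 2 * ν b ^ 2), ← Finset.mul_sum, hv]
    simp only [Finset.prod_const, Finset.card_univ, Fintype.card_fin]
    calc (2 * ((1 + q ^ 2) / 2)) ^ n = (q ^ 2 + 1) ^ n := by ring
      _ ≤ Real.exp (q ^ 2) ^ n :=
        pow_le_pow_left₀ (by positivity) (Real.add_one_le_exp _) n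
      _ = Real.exp (n * q ^ 2) := by rw [← Real.exp_nat_mul]
      _ ≤ Real.exp 1 := Real.exp_le_exp.mpr hnq
      _ ≤ 3 := by linarith [Real.exp_one_lt_d9]
  have h3 : ∑ X : Input n, (∏ i, ν (X i)) * (if 1 ≤ f X then 1 else 0) ≤
      ∑ X : Input n, (1 / 100 * ((2 : ℝ) ^ n * (∏ i, ν (X i)) ^ 2) + 25 * (f X * mu1 n X)) := by
    refine Finset.sum_le_sum fun X _ => ?_
    have hm : (2 : ℝ) ^ n * mu1 n X = 1 := by simp [mu1]
    have hpos : (0 : ℝ) < 2 ^ n := by positivity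
    have hm0 : 0 ≤ mu1 n X := by simp [mu1]
    set a := ∏ i, ν (X i)
    set m := mu1 n X
    set P := (2 : ℝ) ^ n
    split_ifs with h
    -- AM-GM: `a ≤ P * a² / 100 + 25 * m`; then `m ≤ f X * m` as in Markov's inequality.
    · have h4 : 0 ≤ P * (1 / 10 * a - 5 * m) ^ 2 := by positivity
      have h5 : P * (1 / 10 * a - 5 * m) ^ 2 =
          1 / 100 * (P * a ^ 2) - a * (P * m) + 25 * m * (P * m) := by ring
      rw [h5, hm] at h4
      nlinarith
    · have := hf X
      rw [mul_zero]
      positivity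
  rw [Finset.sum_add_distrib, ← Finset.mul_sum Finset.univ _ (1 / 100 : ℝ),
    ← Finset.mul_sum Finset.univ _ (25 : ℝ)] at h3
  linarith

/-- A lower tail bound for the number of sites at which `v` exceeds `u`. -/
theorem sum_weight_exp_le (h0 : 0 ≤ q) (h1 : q ≤ 1) (u v : Bool × Bool → Bool)
    (hle : ∀ a, u a ≤ v a) (huv : ∑ a, (if u a = v a then 0 else siteWeight q a) = q / 2) :
    ∑ ω : Fin n → Bool × Bool, weight q ω * Real.exp (n * q / 8 -
      n * (mean (fun i => v (ω i)) - mean (fun i => u (ω i)))) ≤ Real.exp (-(n * q / 8)) := by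
  have e1 : ∀ ω : Fin n → Bool × Bool, weight q ω * Real.exp (n * q / 8 -
      n * (mean (fun i => v (ω i)) - mean (fun i => u (ω i)))) = Real.exp (n * q / 8) *
      ∏ i, (siteWeight q (ω i) * if u (ω i) = v (ω i) then 1 else Real.exp (-1)) := by
    intro ω
    have e2 : n * (mean (fun i => v (ω i)) - mean (fun i => u (ω i))) =
        ∑ i, if u (ω i) = v (ω i) then (0 : ℝ) else 1 := by
      rcases Nat.eq_zero_or_pos n with rfl | hn
      · simp
      have hn' : (n : ℝ) ≠ 0 := by positivity
      unfold mean
      rw [← sub_div, mul_div_cancel₀ _ hn', ← Finset.sum_sub_distrib]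
      refine Finset.sum_congr rfl fun i _ => ?_
      have bits : ∀ b b' : Bool, b ≤ b' → (if b' then (1 : ℝ) else 0) - (if b then 1 else 0) =
          if b = b' then 0 else 1 := by
        intro b b'
        cases b <;> cases b' <;> simp
      exact bits _ _ (hle (ω i))
    have e3 : Real.exp (-∑ i, if u (ω i) = v (ω i) then (0 : ℝ) else 1) =
        ∏ i, if u (ω i) = v (ω i) then 1 else Real.exp (-1) := by
      rw [← Finset.sum_neg_distrib, Real.exp_sum]
      refine Finset.prod_congr rfl fun i _ => ?_
      split_ifs <;> simp
    rw [e2, sub_eq_add_neg, Real.exp_add, e3, Finset.prod_mul_distrib, weight]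
    ring
  simp_rw [e1]
  rw [← Finset.mul_sum, sum_pi_prod (fun (_ : Fin n) a =>
    siteWeight q a * if u a = v a then 1 else Real.exp (-1))]
  have e4 : ∑ a, (siteWeight q a * if u a = v a then 1 else Real.exp (-1)) =
      1 - (1 - Real.exp (-1)) * (q / 2) := by
    have hone : ∑ a, siteWeight q a = 1 := by
      simp [Fintype.sum_prod_type, siteWeight]; ring
    rw [← huv, Finset.mul_sum]
    refine Eq.trans ?_ (congrArg (· - ∑ a, (1 - Real.exp (-1)) *
      if u a = v a then 0 else siteWeight q a) hone)
    rw [← Finset.sum_sub_distrib]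
    refine Finset.sum_congr rfl fun a _ => ?_
    split_ifs <;> ring
  have hexp : Real.exp (-1) ≤ 1 / 2 := by linarith [Real.exp_neg_one_lt_d9]
  have hexp0 := Real.exp_pos (-1)
  simp only [e4, Finset.prod_const, Finset.card_univ, Fintype.card_fin]
  calc Real.exp (n * q / 8) * (1 - (1 - Real.exp (-1)) * (q / 2)) ^ n
      ≤ Real.exp (n * q / 8) * Real.exp (-(q / 4)) ^ n := by
        refine mul_le_mul_of_nonneg_left (pow_le_pow_left₀ (by nlinarith) ?_ n) (Real.exp_pos _).le
        have := Real.add_one_le_exp (-(q / 4))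
        nlinarith
    _ = Real.exp (-(n * q / 8)) := by
        rw [← Real.exp_nat_mul, ← Real.exp_add]
        congr 1
        ring

end Coupling

/-! ### Lower bounds for the error and for the number of queries. -/

/-- The lower bound for the average error in terms of the flip probability `q` of the coupling. -/
theorem avgError_ge {n T : ℕ} (A : QuantumAlgorithm n T) {p q : ℝ} (hp : 1 / 2 < p) (hp1 : p ≤ 1)
    (h0 : 0 < q) (h1 : q ≤ 1) (hnq2 : n * q ^ 2 ≤ 1) (hnq : 72 ≤ n * q)
    (hT : 1000 * (q * T) ≤ 1) : q / 8000 ≤ A.avgError p (mu1 n) := by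
  by_contra! hlt
  set f : Input n → ℝ := fun X => A.error p X / (q / 16) with hf
  have hf0 : ∀ X, 0 ≤ f X := fun X =>
    div_nonneg (A.error_nonneg (by linarith) X) (by linarith)
  have hfsum : ∑ X, f X * mu1 n X ≤ 2 / 1000 := by
    have : ∑ X, f X * mu1 n X = A.avgError p (mu1 n) / (q / 16) := by
      rw [QuantumAlgorithm.avgError, Finset.sum_div]
      exact Finset.sum_congr rfl fun X _ => by simp only [hf]; ring
    rw [this, div_le_iff₀ (by linarith)]
    linarith
  let y : Bool × Bool → Bool := fun a => a.1 || a.2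
  let z : Bool × Bool → Bool := fun a => a.1 && !a.2
  have bX := sum_weight_mul_fst (q := q) f
  have bY := sum_weight_indicator_le hnq2 y
    (by simp [Fintype.sum_prod_type, siteWeight, y]; ring) f hf0
  have bZ := sum_weight_indicator_le hnq2 z
    (by simp [Fintype.sum_prod_type, siteWeight, z]; ring) f hf0
  have gY := sum_weight_exp_le (n := n) h0.le h1 Prod.fst y (by decide)
    (by simp [Fintype.sum_prod_type, siteWeight, y])
  have gZ := sum_weight_exp_le (n := n) h0.le h1 z Prod.fst (by decide)
    (by simp [Fintype.sum_prod_type, siteWeight, z])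
  have dY := sum_weight_mul_norm_sq_le A h0.le h1 Prod.fst y
    (by intro b; cases b <;> simp [Fintype.sum_prod_type, siteWeight, y] <;> nlinarith)
    (by intro b; cases b <;> simp [Fintype.sum_prod_type, siteWeight, y] <;> nlinarith) T
  have dZ := sum_weight_mul_norm_sq_le A h0.le h1 Prod.fst z
    (by intro b; cases b <;> simp [Fintype.sum_prod_type, siteWeight, z] <;> nlinarith)
    (by intro b; cases b <;> simp [Fintype.sum_prod_type, siteWeight, z] <;> nlinarith) T
  have hexp : Real.exp (-(n * q / 8)) ≤ 1 / 10 := by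
    rw [Real.exp_neg, one_div]
    exact inv_anti₀ (by norm_num) (by linarith [Real.add_one_le_exp (n * q / 8)])
  -- First-moment method: the expectation is at most `0.002 + 2 * 0.08 + 2 * 0.1 + 2 * 0.12 < 1`.
  -- All terms are nonnegative, so each is below one at this `ω`.
  obtain ⟨ω, hω⟩ : ∃ ω : Fin n → Bool × Bool,
      f (fun i => (ω i).1) + (if 1 ≤ f (fun i => y (ω i)) then 1 else 0) +
      (if 1 ≤ f (fun i => z (ω i)) then 1 else 0) +
      Real.exp (n * q / 8 - n * (mean (fun i => y (ω i)) - mean (fun i => (ω i).1))) +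
      Real.exp (n * q / 8 - n * (mean (fun i => (ω i).1) - mean (fun i => z (ω i)))) +
      30 * ‖A.stateAfter (fun i => (ω i).1) T - A.stateAfter (fun i => y (ω i)) T‖ ^ 2 +
      30 * ‖A.stateAfter (fun i => (ω i).1) T - A.stateAfter (fun i => z (ω i)) T‖ ^ 2 < 1 := by
    by_contra! hall
    have key := Finset.sum_le_sum fun (ω : Fin n → Bool × Bool) (_ : ω ∈ Finset.univ) =>
      mul_le_mul_of_nonneg_left (hall ω) (weight_nonneg h0.le h1 ω)
    simp only [mul_one, sum_weight, mul_add, Finset.sum_add_distrib, mul_left_comm _ (30 : ℝ),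
      ← Finset.mul_sum] at key
    linarith
  have pX := hf0 (fun i => (ω i).1)
  have pgY := Real.exp_pos (n * q / 8 - n * (mean (fun i => y (ω i)) - mean (fun i => (ω i).1)))
  have pgZ := Real.exp_pos (n * q / 8 - n * (mean (fun i => (ω i).1) - mean (fun i => z (ω i))))
  have pdY := sq_nonneg
    ‖A.stateAfter (fun i => (ω i).1) T - A.stateAfter (fun i => y (ω i)) T‖
  have pdZ := sq_nonneg
    ‖A.stateAfter (fun i => (ω i).1) T - A.stateAfter (fun i => z (ω i)) T‖
  have piY : (0 : ℝ) ≤ if 1 ≤ f (fun i => y (ω i)) then 1 else 0 := by split_ifs <;> norm_num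
  have piZ : (0 : ℝ) ≤ if 1 ≤ f (fun i => z (ω i)) then 1 else 0 := by split_ifs <;> norm_num
  have small : ∀ X, f X < 1 → A.error p X < q / 16 := fun X hX => by
    rwa [hf, div_lt_one (by linarith)] at hX
  have ind : ∀ r : ℝ, (if 1 ≤ r then (1 : ℝ) else 0) < 1 → r < 1 := fun r hr => by
    by_contra! h
    simp [h] at hr
  have hn : (0 : ℝ) < n := by
    by_contra! h
    nlinarith
  have gap : ∀ r : ℝ, Real.exp (n * q / 8 - n * r) < 1 → 2 * (q / 16) < r := fun r hr => by
    rw [Real.exp_lt_one_iff] at hr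
    nlinarith
  exact A.not_three_errors_lt (X := fun i => (ω i).1) (Y := fun i => y (ω i))
    (Z := fun i => z (ω i)) hp hp1 (small _ (by linarith)) (small _ (ind _ (by linarith)))
    (small _ (ind _ (by linarith))) (gap _ (by linarith)) (gap _ (by linarith))
    (by linarith) (by linarith)

/-- The common core of both parts of the lower bound. -/
theorem avgError_ge_min {n T : ℕ} (A : QuantumAlgorithm n T) {p : ℝ} (hp : 1 / 2 < p)
    (hp1 : p ≤ 1) (hn : 72000 ^ 2 ≤ n) (hT : 72000 * (T : ℝ) ≤ n) :
    1 / 8000000 * min (Real.sqrt n)⁻¹ (max 1 (T : ℝ))⁻¹ ≤ A.avgError p (mu1 n) := by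
  have hn' : (72000 : ℝ) ^ 2 ≤ n := by exact_mod_cast hn
  have hs : (72000 : ℝ) ≤ Real.sqrt n := Real.le_sqrt_of_sq_le hn'
  have hsq : Real.sqrt n * Real.sqrt n = n := Real.mul_self_sqrt (Nat.cast_nonneg n)
  have hT0 : (0 : ℝ) ≤ T := Nat.cast_nonneg T
  set s := Real.sqrt n
  -- With `q = 1 / (1000 * M)`, `M ≥ √n` gives `n * q ^ 2 ≤ 1`, `M ≥ T` gives `1000 * q * T ≤ 1`,
  -- and `72000 * M ≤ n` gives `n * q ≥ 72`.
  set M := max s T with hM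
  have hsM : s ≤ M := le_max_left _ _
  have hTM : (T : ℝ) ≤ M := le_max_right _ _
  have hMpos : 0 < M := by linarith
  have hMn : 72000 * M ≤ n := by
    rcases max_choice s (T : ℝ) with h | h <;> rw [hM, h] <;> nlinarith
  have hq := avgError_ge A (q := 1 / 1000 * M⁻¹) hp hp1 (by positivity) ?_ ?_ ?_ ?_
  · refine le_trans ?_ hq
    have : min s⁻¹ (max 1 (T : ℝ))⁻¹ ≤ M⁻¹ := by
      rcases max_choice s (T : ℝ) with h | h
      · rw [hM, h]; exact min_le_left _ _
      · rw [hM, h]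
        have h1 : (1 : ℝ) ≤ T := by
          have := max_eq_right_iff.mp h
          linarith
        rw [max_eq_right h1]; exact min_le_right _ _
    linarith
  · have : M⁻¹ ≤ 1 := inv_le_one_of_one_le₀ (by linarith)
    linarith
  · have : (n : ℝ) * (1 / 1000 * M⁻¹) ^ 2 = 1 / 1000000 * (n / M ^ 2) := by field_simp; norm_num
    rw [this]
    have : (n : ℝ) / M ^ 2 ≤ 1 := by
      rw [div_le_one (by positivity)]
      nlinarith
    linarith
  · have : (n : ℝ) * (1 / 1000 * M⁻¹) = n / M / 1000 := by field_simp
    rw [this]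
    have : 72000 ≤ (n : ℝ) / M := by rwa [le_div_iff₀ hMpos]
    linarith
  · have : 1000 * (1 / 1000 * M⁻¹ * T) = T / M := by field_simp
    rw [this]
    exact (div_le_one hMpos).mpr hTM

end BoolMean

/- In the first part `T⁻¹` is read as `(max 1 T)⁻¹`; for `T = 0` the minimum is then `n^{-1/2}`, as
it is with the convention `0⁻¹ = ∞`. -/
theorem theorem3p2 :
    (∃ c : ℝ, 0 < c ∧ ∀ p : ℝ, 1 / 2 < p → p ≤ 1 → ∀ T : ℕ → ℕ,
      (fun n => (T n : ℝ)) =o[atTop] (fun n : ℕ => (n : ℝ)) →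
      ∀ᶠ n : ℕ in atTop, ∀ A : BoolMean.QuantumAlgorithm n (T n),
        c * min (Real.sqrt n)⁻¹ (max 1 (T n : ℝ))⁻¹ ≤ A.avgError p (BoolMean.mu1 n)) ∧
    (∃ c : ℝ, 0 < c ∧ ∀ p : ℝ, 1 / 2 < p → p ≤ 1 → ∀ ε : ℕ → ℝ, (∀ n, 0 < ε n) →
      ε =o[atTop] (fun n : ℕ => (Real.sqrt n)⁻¹) →
      ∀ᶠ n : ℕ in atTop, ∀ (T : ℕ) (A : BoolMean.QuantumAlgorithm n T),
        A.avgError p (BoolMean.mu1 n) ≤ ε n → c * min (ε n)⁻¹ (n : ℝ) ≤ (T : ℝ)) := by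
  refine ⟨⟨1 / 8000000, by norm_num, fun p hp hp1 T hT => ?_⟩,
    ⟨1 / 16000000, by norm_num, fun p hp hp1 ε hε hεo => ?_⟩⟩
  · filter_upwards [hT.def (show (0 : ℝ) < 1 / 72000 by norm_num),
      eventually_ge_atTop (72000 ^ 2)] with n h1 h2 A
    rw [Real.norm_natCast, Real.norm_natCast] at h1
    exact BoolMean.avgError_ge_min A hp hp1 h2 (by linarith)
  · filter_upwards [hεo.def (show (0 : ℝ) < 1 / 16000000 by norm_num),
      eventually_ge_atTop (72000 ^ 2)] with n h1 h2 T A hA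
    by_cases hT : 72000 * (T : ℝ) ≤ n
    · have hcore := (BoolMean.avgError_ge_min A hp hp1 h2 hT).trans hA
      have hn' : (72000 : ℝ) ^ 2 ≤ n := by exact_mod_cast h2
      have hs : (72000 : ℝ) ≤ Real.sqrt n := Real.le_sqrt_of_sq_le hn'
      have hpos := hε n
      have hspos : 0 < (Real.sqrt n)⁻¹ := by positivity
      rw [Real.norm_of_nonneg hpos.le, Real.norm_of_nonneg hspos.le] at h1
      set M := max 1 (T : ℝ) with hM
      have hMpos : 0 < M := lt_of_lt_of_le one_pos (le_max_left _ _)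
      -- The minimum cannot be `(√n)⁻¹`, since `ε n` is at most half of `(√n)⁻¹ / 8000000`.
      have h3 : M⁻¹ ≤ 8000000 * ε n := by
        rcases min_choice (Real.sqrt n)⁻¹ M⁻¹ with h | h <;> rw [h] at hcore <;> linarith
      have h4 : (ε n)⁻¹ ≤ 8000000 * M := by
        rw [inv_le_comm₀ hMpos (by positivity)] at h3
        rw [mul_inv] at h3
        linarith
      -- This excludes `M = 1`, so `M` is the number of queries.
      have h5 : 16000000 * 72000 ≤ (ε n)⁻¹ := by
        have h6 : ε n ≤ (16000000 * 72000)⁻¹ := by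
          have : (Real.sqrt n)⁻¹ ≤ 72000⁻¹ := inv_anti₀ (by norm_num) hs
          rw [mul_inv]
          linarith
        exact (le_inv_comm₀ (by norm_num) hpos).mpr h6
      have h7 : M = T := by
        rcases max_choice 1 (T : ℝ) with h | h
        · rw [hM, h] at h4
          linarith
        · exact h
      rw [h7] at h4
      have := min_le_left (ε n)⁻¹ (n : ℝ)
      have hT0 : (0 : ℝ) ≤ T := Nat.cast_nonneg T
      linarith
    · have := min_le_right (ε n)⁻¹ (n : ℝ)
      have hT0 : (0 : ℝ) ≤ T := Nat.cast_nonneg T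
      push Not at hT
      linarith
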